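/- Let $n\ge 0$ and $d\ge 1$ be integers and let $P\in\mathbb{C}[x_0,\dots,x_n]$ be a nonzero form of degree $d$. The rank $\mathrm{r}(P)$ is the minimal $r$ such that $P=L_1^d+\cdots+L_r^d$ for some linear forms $L_1,\dots,L_r\in\mathbb{C}[x_0,\dots,x_n]$. Let $X_{n,d}\subset\mathbb{P}^{N}$, $N=\binom{n+d}{d}-1$, be the Veronese variety of the classes $[L^d]$ of $d$-th powers of nonzero linear forms in the projective space of degree $d$ forms. A zero-dimensional closed subscheme $Z\subset\mathbb{P}^N$ is called curvilinear if its Zariski tangent space at each of its points has dimension at most $1$; $\langle Z\rangle$ denotes the intersection of all hyperplanes that contain the scheme $Z$. The curvilinear rank of $P$ is $$\mathrm{Cr}(P):=\min\{\deg(Z)\;:\; Z\subset X_{n,d}\text{ a zero-dimensional curvilinear subscheme with }[P]\in\langle Z\rangle\}.$$ Both minima are taken over nonempty sets, and $$\mathrm{r}(P)\le(\mathrm{Cr}(P)-1)\,d+2-\mathrm{Cr}(P).$$ -/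

import Mathlib

open MvPolynomial Filter

noncomputable section

namespace CurvilinearRank

/-- A closed subscheme of the complex projective space whose homogeneous coordinates are indexed
by `σ`, given by its saturated homogeneous ideal in `ℂ[y_i : i ∈ σ]`
(the unit ideal is the empty subscheme). -/
structure ProjSubscheme (σ : Type*) where
  ideal : Ideal (MvPolynomial σ ℂ)
  homogeneous : ∀ F ∈ ideal, ∀ t : ℕ, homogeneousComponent t F ∈ ideal
  saturated : ∀ F : MvPolynomial σ ℂ, (∀ i, X i * F ∈ ideal) → F ∈ ideal

namespace ProjSubscheme

variable {σ : Type*}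

/-- The Hilbert function `t ↦ dim (S/I)_t`. -/
def hilbertFunction (Z : ProjSubscheme σ) (t : ℕ) : ℕ :=
  Module.finrank ℂ (homogeneousSubmodule σ ℂ t ⧸
    (Z.ideal.restrictScalars ℂ).submoduleOf (homogeneousSubmodule σ ℂ t))

/-- `Z` is zero-dimensional (or empty, if `k = 0`) of degree (length) `k`:
its Hilbert polynomial is the constant `k`. -/
def IsZeroDimOfDegree (Z : ProjSubscheme σ) (k : ℕ) : Prop :=
  ∀ᶠ t in atTop, Z.hilbertFunction t = k

/-- The point with homogeneous coordinates `v` lies on `Z`. -/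
def HasPoint (Z : ProjSubscheme σ) (v : σ → ℂ) : Prop :=
  v ≠ 0 ∧ ∀ F ∈ Z.ideal, eval v F = 0

/-- The Zariski tangent space of `Z` at the point `[v]`, as a subspace of `ℂ^σ / ℂ v`, the tangent
space of the projective space at `[v]`: the classes of the vectors that are killed by the
differentials at `v` of all the equations of `Z`. -/
def tangentSpace [Fintype σ] (Z : ProjSubscheme σ) (v : σ → ℂ) :
    Submodule ℂ ((σ → ℂ) ⧸ Submodule.span ℂ {v}) :=
  Submodule.map (Submodule.span ℂ {v}).mkQ
    (⨅ F ∈ Z.ideal,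
      LinearMap.ker (∑ i, eval v (pderiv i F) • (LinearMap.proj i : (σ → ℂ) →ₗ[ℂ] ℂ)))

/-- At each of its points, `Z` has a Zariski tangent space of dimension at most one. -/
def IsCurvilinear [Fintype σ] (Z : ProjSubscheme σ) : Prop :=
  ∀ v, Z.HasPoint v → Module.finrank ℂ (Z.tangentSpace v) ≤ 1

/-- The (affine cone over the) linear span of `Z`: the common zeros of all the linear forms that
vanish on the scheme `Z`. -/
def span (Z : ProjSubscheme σ) : Set (σ → ℂ) :=
  {v | ∀ F ∈ Z.ideal, F.IsHomogeneous 1 → eval v F = 0}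

end ProjSubscheme

/-- Exponents of the monomials of degree `d` in `x_0, …, x_n`; they index the homogeneous
coordinates of the projective space of degree `d` forms. -/
abbrev Expo (n d : ℕ) : Type :=
  {a : Fin (n + 1) →₀ ℕ // a ∈ (Finset.univ : Finset (Fin (n + 1))).finsuppAntidiag d}

/-- The coordinates (coefficients) of a degree `d` form. -/
def coords (n d : ℕ) (P : MvPolynomial (Fin (n + 1)) ℂ) : Expo n d → ℂ :=
  fun a => coeff a.1 P

/-- The (affine cone over the) Veronese variety `X_{n,d}`: all `d`-th powers of linear forms. -/
def veroneseCone (n d : ℕ) : Set (Expo n d → ℂ) :=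
  {v | ∃ L : MvPolynomial (Fin (n + 1)) ℂ, L.IsHomogeneous 1 ∧ v = coords n d (L ^ d)}

/-- `Z` is a subscheme of the Veronese variety `X_{n,d}`. -/
def InVeronese {n d : ℕ} (Z : ProjSubscheme (Expo n d)) : Prop :=
  vanishingIdeal ℂ (veroneseCone n d) ≤ Z.ideal

/-- The numbers `r` such that `P` is a sum of `r` `d`-th powers of linear forms. -/
def powerSumLengths (n d : ℕ) (P : MvPolynomial (Fin (n + 1)) ℂ) : Set ℕ :=
  {r | ∃ L : Fin r → MvPolynomial (Fin (n + 1)) ℂ,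
    (∀ i, (L i).IsHomogeneous 1) ∧ P = ∑ i, L i ^ d}

/-- The rank of a degree `d` form. -/
def rank (n d : ℕ) (P : MvPolynomial (Fin (n + 1)) ℂ) : ℕ :=
  sInf (powerSumLengths n d P)

/-- The degrees of the curvilinear zero-dimensional subschemes of `X_{n,d}` whose span
contains `[P]`. -/
def curvilinearLengths (n d : ℕ) (P : MvPolynomial (Fin (n + 1)) ℂ) : Set ℕ :=
  {k | ∃ Z : ProjSubscheme (Expo n d), Z.IsZeroDimOfDegree k ∧ Z.IsCurvilinear ∧
    InVeronese Z ∧ coords n d P ∈ Z.span}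

/-- The curvilinear rank of a degree `d` form. -/
def curvilinearRank (n d : ℕ) (P : MvPolynomial (Fin (n + 1)) ℂ) : ℕ :=
  sInf (curvilinearLengths n d P)

end CurvilinearRank

end

/-!
Restricting `Z` to the affine chart given by a hyperplane that avoids its points turns the
coefficients of `P` into the values of a linear functional `φ` on the coefficients of
`(∑ y_i x_i)^d`, where the `y_i` lie in an algebra `A` of dimension at most `deg Z`.
Curvilinearity makes each maximal ideal of `A` principal modulo its square, so `A = ℂ[s]` by the
Chinese remainder theorem and Nakayama's lemma. Replacing `φ` by a functional `Φ` on `ℂ[X]` whose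
apolar ideal is generated by a polynomial `g` of degree `k + 1 ≤ deg Z`, and reducing the `y_i`
modulo `g`, one may take all `y_i` to be polynomials of degree at most `k`. The coefficients above
then have degree at most `k d`, and Sylvester's argument expresses `Φ` on such polynomials through
evaluations at `k (d - 1) + 1` distinct points: a general member of the pencil spanned by a multiple
of `g` and a polynomial `b` that is orthogonal to all low degrees has simple roots. Each evaluation
contributes one `d`-th power.

For the existence of `Z`, a basis of the space of forms of degree `d` that consists of `d`-th powers
gives a reduced scheme with span the whole space.
-/

open scoped Polynomial

noncomputable section

namespace CurvilinearRank

/-- The largest ideal contained in the kernel of a linear map `Φ` on a commutative algebra; for a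
functional on `K[X]` this is the apolar ideal of Sylvester's theory of binary forms. -/
def apolarIdeal {R A M : Type*} [CommSemiring R] [CommSemiring A] [Algebra R A] [AddCommMonoid M]
    [Module R M] (Φ : A →ₗ[R] M) : Ideal A where
  carrier := {p | ∀ q, Φ (p * q) = 0}
  add_mem' hp hq r := by rw [add_mul, map_add, hp, hq, add_zero]
  zero_mem' r := by rw [zero_mul, map_zero]
  smul_mem' a p hp r := by rw [smul_eq_mul, mul_comm a, mul_assoc, hp]

section Sylvester

variable {K : Type*} [Field K]

theorem exists_monic_eq_span_singleton {I : Ideal K[X]} (hI : I ≠ ⊥) :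
    ∃ g : K[X], g.Monic ∧ I = Ideal.span {g} := by
  classical
  have hgen : Submodule.IsPrincipal.generator I ≠ 0 := fun h =>
    hI ((Submodule.IsPrincipal.eq_bot_iff_generator_eq_zero I).2 h)
  refine ⟨normalize (Submodule.IsPrincipal.generator I), Polynomial.monic_normalize hgen, ?_⟩
  rw [Ideal.span_singleton_eq_span_singleton.2 (normalize_associated _),
    Ideal.span_singleton_generator]

theorem exists_irreducible_dvd_wronskian_of_not_separable {f : K[X]} (hf : f ≠ 0)
    (hsep : ¬f.Separable) (b : K[X]) : ∃ p, Irreducible p ∧ p ∣ f ∧ p ∣ f.wronskian b := by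
  obtain ⟨p, hp, hpf, hpf'⟩ : ∃ p, Irreducible p ∧ p ∣ f ∧ p ∣ f.derivative := by
    by_contra! h
    exact hsep (isCoprime_of_irreducible_dvd (fun h0 => hf h0.1) h)
  exact ⟨p, hp, hpf, dvd_sub (hpf.mul_right _) (hpf'.mul_right _)⟩

theorem exists_separable_add_C_mul [CharZero K] {G b : K[X]} (hdeg : 0 < G.natDegree)
    (hcop : IsCoprime G b) : ∃ c, (G + Polynomial.C c * b).Separable := by
  classical
  have hW : G.wronskian b ≠ 0 := fun h =>
    hdeg.ne' (Polynomial.derivative_eq_zero.1 (hcop.wronskian_eq_zero_iff.1 h).1)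
  have hpencil (c : K) : (G + Polynomial.C c * b).wronskian b = G.wronskian b := by
    simp only [Polynomial.wronskian, Polynomial.derivative_add, Polynomial.derivative_C_mul]
    ring
  -- All members of the pencil have the same Wronskian with `b`, so if none of them is separable,
  -- two of them share an irreducible factor, which then divides both `G` and `b`.
  by_contra! hsep
  have hbad (c : K) : ∃ p ∈ UniqueFactorizationMonoid.normalizedFactors (G.wronskian b),
      p ∣ G + Polynomial.C c * b := by
    have hne : G + Polynomial.C c * b ≠ 0 := fun h => hW <| by
      rw [← hpencil c, h, Polynomial.wronskian_zero_left]
    obtain ⟨p, hp, hpf, hpW⟩ := exists_irreducible_dvd_wronskian_of_not_separable hne (hsep c) b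
    obtain ⟨p', hp', hassoc⟩ :=
      UniqueFactorizationMonoid.exists_mem_normalizedFactors_of_dvd hW hp (hpencil c ▸ hpW)
    exact ⟨p', hp', hassoc.symm.dvd.trans hpf⟩
  choose p hmem hdvd using hbad
  obtain ⟨c, c', hne, heq⟩ := Finite.exists_ne_map_eq_of_infinite fun c =>
    (⟨p c, Multiset.mem_toFinset.2 (hmem c)⟩ :
      (UniqueFactorizationMonoid.normalizedFactors (G.wronskian b)).toFinset)
  have hp : p c = p c' := congrArg Subtype.val heq
  have hdvd' : p c ∣ G + Polynomial.C c' * b := hp ▸ hdvd c'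
  have hpb : p c ∣ b := by
    have hmul : p c ∣ Polynomial.C (c - c') * b := by
      convert dvd_sub (hdvd c) hdvd' using 1
      rw [Polynomial.C_sub]
      ring
    exact ((Polynomial.isUnit_C.2 (sub_ne_zero.2 hne).isUnit).dvd_mul_left).1 hmul
  have hpG : p c ∣ G := (dvd_add_left (hpb.mul_left _)).1 (hdvd c)
  exact (UniqueFactorizationMonoid.irreducible_of_normalized_factor _ (hmem c)).not_isUnit
    (hcop.isUnit_of_dvd' hpG hpb)

theorem exists_degree_lt_orthogonal (Φ : K[X] →ₗ[K] K) (k : ℕ) :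
    ∃ b : K[X], b ≠ 0 ∧ b.degree < (k + 1 : ℕ) ∧ ∀ q : K[X], q.degree < k → Φ (b * q) = 0 := by
  let E : Polynomial.degreeLT K (k + 1) →ₗ[K] Module.Dual K (Polynomial.degreeLT K k) :=
    ((LinearMap.mul K K[X]).compr₂ Φ).compl₁₂ (Submodule.subtype _) (Submodule.subtype _)
  have (j : ℕ) : Module.Finite K (Polynomial.degreeLT K j) :=
    Module.Finite.equiv (Polynomial.degreeLTEquiv K j).symm
  have hE : LinearMap.ker E ≠ ⊥ := by
    apply LinearMap.ker_ne_bot_of_finrank_lt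
    simp [Subspace.dual_finrank_eq, (Polynomial.degreeLTEquiv K _).finrank_eq]
  obtain ⟨b, hb, hb0⟩ := Submodule.exists_mem_ne_zero_of_ne_bot hE
  exact ⟨b, by simpa using hb0, Polynomial.mem_degreeLT.1 b.2, fun q hq =>
    LinearMap.congr_fun (LinearMap.mem_ker.1 hb) ⟨q, Polynomial.mem_degreeLT.2 hq⟩⟩

theorem isCoprime_of_orthogonal {Φ : K[X] →ₗ[K] K} {g b : K[X]} {k : ℕ}
    (hΦ : apolarIdeal Φ = Ideal.span {g}) (hg : g.natDegree = k + 1) (hb : b ≠ 0)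
    (hdeg : b.degree < (k + 1 : ℕ)) (horth : ∀ q : K[X], q.degree < k → Φ (b * q) = 0) :
    IsCoprime g b := by
  have hg0 : g ≠ 0 := by rintro rfl; simp at hg
  refine isCoprime_of_dvd g b (fun h => hg0 h.1) fun h hunit _ hhg hhb => ?_
  obtain ⟨g', rfl⟩ := hhg
  obtain ⟨b', hb'⟩ := hhb
  obtain ⟨hh0, hg'0⟩ := mul_ne_zero_iff.1 hg0
  have hdeg' : g'.degree ≤ k := by
    rw [Polynomial.natDegree_mul hh0 hg'0] at hg
    have := Polynomial.natDegree_pos_iff_degree_pos.2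
      (Polynomial.degree_pos_of_ne_zero_of_nonunit hh0 hunit)
    exact Polynomial.natDegree_le_iff_degree_le.1 (by omega)
  have hmem : b ∈ apolarIdeal Φ := fun q => by
    have hq : b * q = b * (q % g') + h * g' * (b' * (q / g')) := by
      conv_lhs => rw [← EuclideanDomain.mod_add_div q g', mul_add, hb']
      rw [hb']
      ring
    have hgen : h * g' ∈ apolarIdeal Φ := hΦ ▸ Ideal.mem_span_singleton_self _
    rw [hq, map_add, hgen, horth _ ((EuclideanDomain.mod_lt q hg'0).trans_le hdeg'), add_zero]
  have hle := Polynomial.degree_le_of_dvd (Ideal.mem_span_singleton.1 (hΦ ▸ hmem)) hb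
  rw [Polynomial.degree_eq_natDegree hg0, hg] at hle
  exact hle.not_gt hdeg

theorem exists_nodal_orthogonal [IsAlgClosed K] [CharZero K] {Φ : K[X] →ₗ[K] K} {g : K[X]}
    {k e : ℕ} (hΦ : apolarIdeal Φ = Ideal.span {g}) (hmonic : g.Monic) (hg : g.natDegree = k + 1)
    (he : k + 1 ≤ e) : ∃ s : Finset K, s.card = e ∧
      ∀ q : K[X], q.degree < k → Φ (Lagrange.nodal s id * q) = 0 := by
  classical
  obtain ⟨b, hb, hdeg, horth⟩ := exists_degree_lt_orthogonal Φ k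
  obtain ⟨β, hβ⟩ : ∃ β, b.eval β ≠ 0 := by
    by_contra! h
    exact hb (Polynomial.funext fun x => by simpa using h x)
  set G := g * (Polynomial.X - Polynomial.C β) ^ (e - (k + 1))
  have hGmonic : G.Monic := hmonic.mul ((Polynomial.monic_X_sub_C β).pow _)
  have hGdeg : G.natDegree = e := by
    rw [hmonic.natDegree_mul ((Polynomial.monic_X_sub_C β).pow _), hg, Polynomial.natDegree_pow,
      Polynomial.natDegree_X_sub_C]
    omega
  have hcop : IsCoprime G b :=
    (isCoprime_of_orthogonal hΦ hg hb hdeg horth).mul_left <| IsCoprime.pow_left <|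
      (Polynomial.irreducible_X_sub_C β).coprime_iff_not_dvd.2 fun h =>
        hβ (Polynomial.dvd_iff_isRoot.1 h)
  obtain ⟨c, hsep⟩ := exists_separable_add_C_mul (by omega) hcop
  set h := G + Polynomial.C c * b
  have hlt : (Polynomial.C c * b).degree < G.degree := by
    rw [Polynomial.degree_eq_natDegree hGmonic.ne_zero, hGdeg, ← Polynomial.smul_eq_C_mul]
    exact (Polynomial.degree_smul_le c b).trans_lt (hdeg.trans_le (by exact_mod_cast he))
  have hroots : h.roots.toFinset.val = h.roots :=
    (Polynomial.nodup_roots hsep).dedup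
  have hnodal : Lagrange.nodal h.roots.toFinset id = h := by
    rw [Lagrange.nodal, Finset.prod, hroots]
    exact ((IsAlgClosed.splits h).eq_prod_roots_of_monic (hGmonic.add_of_left hlt)).symm
  refine ⟨h.roots.toFinset, ?_, fun q hq => ?_⟩
  · rw [Finset.card, hroots, IsAlgClosed.card_roots_eq_natDegree,
      Polynomial.natDegree_add_eq_left_of_degree_lt hlt, hGdeg]
  · have hgen : g ∈ apolarIdeal Φ := hΦ ▸ Ideal.mem_span_singleton_self g
    rw [hnodal, add_mul, map_add, mul_assoc, hgen, mul_assoc, ← Polynomial.smul_eq_C_mul, map_smul,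
      horth q hq, smul_zero, add_zero]

theorem apply_eq_sum_eval_of_nodal_orthogonal [DecidableEq K] {Φ : K[X] →ₗ[K] K} {s : Finset K}
    {k : ℕ} (horth : ∀ q : K[X], q.degree < k → Φ (Lagrange.nodal s id * q) = 0) {q : K[X]}
    (hq : q.degree < (s.card + k : ℕ)) :
    Φ q = ∑ α ∈ s, q.eval α * Φ (Lagrange.basis s id α) := by
  set h := Lagrange.nodal s (id : K → K)
  have hh : h.Monic := Lagrange.nodal_monic
  have hdeg : h.degree = s.card := Lagrange.degree_nodal
  have hrem : q %ₘ h = Lagrange.interpolate s id fun α => q.eval α := by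
    refine Lagrange.eq_interpolate_of_eval_eq _ Function.injective_id.injOn ?_ fun α hα => ?_
    · exact hdeg ▸ Polynomial.degree_modByMonic_lt q hh
    · rw [Polynomial.modByMonic_eq_sub_mul_div, Polynomial.eval_sub, Polynomial.eval_mul,
        Lagrange.eval_nodal_at_node hα, zero_mul, sub_zero, id]
  have hquot : (q /ₘ h).degree < k := by
    rcases lt_or_ge q.degree h.degree with hlt | hle
    · rw [(Polynomial.divByMonic_eq_zero_iff hh).2 hlt, Polynomial.degree_zero]
      exact WithBot.bot_lt_coe k
    · rw [← Polynomial.degree_add_divByMonic hh hle, hdeg, Nat.cast_add] at hq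
      exact lt_of_add_lt_add_left hq
  conv_lhs => rw [← Polynomial.modByMonic_add_div q h, hrem]
  rw [map_add, horth _ hquot, add_zero, Lagrange.interpolate_apply, map_sum]
  simp only [← Polynomial.smul_eq_C_mul, map_smul, smul_eq_mul]

/-- Sylvester's theorem on the rank of binary forms, for the functional dual to the form. -/
theorem exists_apply_eq_sum_eval [IsAlgClosed K] [CharZero K] {Φ : K[X] →ₗ[K] K} {g : K[X]}
    {k e : ℕ} (hΦ : apolarIdeal Φ = Ideal.span {g}) (hmonic : g.Monic) (hg : g.natDegree = k + 1)
    (he : k + 1 ≤ e) : ∃ (s : Finset K) (w : K → K), s.card = e ∧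
      ∀ q : K[X], q.degree < (e + k : ℕ) → Φ q = ∑ α ∈ s, q.eval α * w α := by
  classical
  obtain ⟨s, rfl, hs⟩ := exists_nodal_orthogonal hΦ hmonic hg he
  exact ⟨s, _, rfl, fun q => apply_eq_sum_eval_of_nodal_orthogonal hs⟩

end Sylvester

section Monogenic

theorem le_of_le_jacobson_of_le_sup_sq {A : Type*} [CommRing A] {J M : Ideal A} (hM : M.FG)
    (hjac : M ≤ J.jacobson) (h : M ≤ J ⊔ M ^ 2) : M ≤ J := by
  rw [sq, ← smul_eq_mul] at h
  rw [Submodule.sup_smul_eq_sup_smul_of_le_smul_of_le_jacobson hM hjac h] at h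
  exact h.trans (sup_le le_rfl Ideal.mul_le_left)

variable {K A : Type*} [Field K] [CommRing A] [Algebra K A] [Module.Finite K A]

theorem exists_separating_generator [Infinite K]
    (h : ∀ m : Ideal A, m.IsMaximal → ∃ π ∈ m, m ≤ Ideal.span {π} ⊔ m ^ 2) :
    ∃ (s : A) (l : MaximalSpectrum A → K), Function.Injective l ∧
      ∀ m, s - algebraMap K A (l m) ∈ m.asIdeal ∧
        m.asIdeal ≤ Ideal.span {s - algebraMap K A (l m)} ⊔ m.asIdeal ^ 2 := by
  have : IsArtinianRing A := IsArtinianRing.of_finite K A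
  obtain ⟨N, ⟨eN⟩⟩ := Finite.exists_equiv_fin (MaximalSpectrum A)
  let l : MaximalSpectrum A → K := fun m => Infinite.natEmbedding K (eN m)
  have hl : Function.Injective l :=
    (Infinite.natEmbedding K).injective.comp (Fin.val_injective.comp eN.injective)
  choose π hπ hgen using fun m : MaximalSpectrum A => h m.asIdeal m.isMaximal
  have hcop : Pairwise (Function.onFun IsCoprime fun m : MaximalSpectrum A => m.asIdeal ^ 2) :=
    fun m m' hne => IsCoprime.pow <| Ideal.isCoprime_iff_sup_eq.2 <|
      Ideal.IsMaximal.coprime_of_ne m.isMaximal m'.isMaximal fun heq =>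
        hne (MaximalSpectrum.ext heq)
  obtain ⟨s, hs⟩ := Ideal.exists_forall_sub_mem_ideal hcop fun m => algebraMap K A (l m) + π m
  simp only [← sub_sub] at hs
  refine ⟨s, l, hl, fun m => ⟨?_, (hgen m).trans (sup_le ?_ le_sup_right)⟩⟩
  · exact (Submodule.sub_mem_iff_left _ (hπ m)).1 (Ideal.pow_le_self two_ne_zero (hs m))
  · rw [Ideal.span_singleton_le_iff_mem]
    have hmem : s - algebraMap K A (l m) ∈
        Ideal.span {s - algebraMap K A (l m)} ⊔ m.asIdeal ^ 2 :=
      Ideal.mem_sup_left (Ideal.mem_span_singleton_self _)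
    simpa using sub_mem hmem (Ideal.mem_sup_right (hs m))

theorem isMaximal_span_sub_algebraMap {s : A} {l : MaximalSpectrum A → K}
    (hl : Function.Injective l)
    (hs : ∀ m, s - algebraMap K A (l m) ∈ m.asIdeal ∧
      m.asIdeal ≤ Ideal.span {s - algebraMap K A (l m)} ⊔ m.asIdeal ^ 2)
    {c : K} (hc : Ideal.span {s - algebraMap K A c} ≠ ⊤) :
    (Ideal.span {s - algebraMap K A c}).IsMaximal := by
  have : IsNoetherianRing A := IsNoetherianRing.of_finite K A
  set J : Ideal A := Ideal.span {s - algebraMap K A c}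
  have hlam (m : MaximalSpectrum A) (hm : J ≤ m.asIdeal) : l m = c := by
    by_contra hne
    refine m.isMaximal.ne_top (Ideal.eq_top_of_isUnit_mem _ (x := algebraMap K A (l m - c)) ?_
      ((sub_ne_zero.2 hne).isUnit.map _))
    simpa using sub_mem (hm (Ideal.mem_span_singleton_self _)) (hs m).1
  obtain ⟨M, hM, hJM⟩ := Ideal.exists_le_maximal J hc
  have hMc := hlam ⟨M, hM⟩ hJM
  have hjac : M ≤ J.jacobson := le_sInf fun m' hm' =>
    (congrArg MaximalSpectrum.asIdeal (hl (hMc.trans (hlam ⟨m', hm'.2⟩ hm'.1).symm))).le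
  have hgen := (hs ⟨M, hM⟩).2
  rw [hMc] at hgen
  rwa [hJM.antisymm (le_of_le_jacobson_of_le_sup_sq (IsNoetherian.noetherian M) hjac hgen)]

variable [IsAlgClosed K]

theorem exists_algHom_ker_eq (m : Ideal A) [m.IsMaximal] :
    ∃ ε : A →ₐ[K] K, RingHom.ker ε = m := by
  let _ := Ideal.Quotient.field m
  let E : K ≃ₐ[K] A ⧸ m := AlgEquiv.ofBijective (Algebra.ofId K (A ⧸ m))
    (IsAlgClosed.algebraMap_bijective_of_isIntegral (k := K) (K := A ⧸ m))
  refine ⟨E.symm.toAlgHom.comp (Ideal.Quotient.mkₐ K m), Ideal.ext fun a => ?_⟩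
  simp [RingHom.mem_ker, Ideal.Quotient.eq_zero_iff_mem]

theorem exists_eq_algebraMap_add_mul {s : A} {c : K}
    (hc : Ideal.span {s - algebraMap K A c} ≠ ⊤ → (Ideal.span {s - algebraMap K A c}).IsMaximal)
    (a : A) : ∃ (z : K) (b : A), a = algebraMap K A z + (s - algebraMap K A c) * b := by
  suffices ∃ z : K, a - algebraMap K A z ∈ Ideal.span {s - algebraMap K A c} by
    obtain ⟨z, hz⟩ := this
    obtain ⟨b, hb⟩ := Ideal.mem_span_singleton.1 hz
    exact ⟨z, b, eq_add_of_sub_eq' hb⟩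
  by_cases htop : Ideal.span {s - algebraMap K A c} = ⊤
  · exact ⟨0, htop ▸ Submodule.mem_top⟩
  · have := hc htop
    obtain ⟨ε, hε⟩ := exists_algHom_ker_eq (K := K) (Ideal.span {s - algebraMap K A c})
    exact ⟨ε a, hε ▸ by simp [RingHom.mem_ker]⟩

theorem aeval_surjective_of_forall_exists {s : A}
    (hs : ∀ (c : K) (a : A), ∃ (z : K) (b : A),
      a = algebraMap K A z + (s - algebraMap K A c) * b) :
    Function.Surjective (Polynomial.aeval (R := K) s) := by
  have key (S : Multiset K) (a : A) : ∃ (p : K[X]) (b : A), a = Polynomial.aeval s p +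
      Polynomial.aeval s (S.map fun c => Polynomial.X - Polynomial.C c).prod * b := by
    induction S using Multiset.induction_on with
    | empty => exact ⟨0, a, by simp⟩
    | cons c S ih =>
      obtain ⟨p, b, rfl⟩ := ih
      obtain ⟨z, b', rfl⟩ := hs c b
      refine ⟨p + (S.map fun c => Polynomial.X - Polynomial.C c).prod * Polynomial.C z, b', ?_⟩
      simp only [Multiset.map_cons, Multiset.prod_cons, map_add, map_mul, map_sub,
        Polynomial.aeval_C, Polynomial.aeval_X]
      ring
  intro a
  obtain ⟨p, b, hab⟩ := key (minpoly K s).roots a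
  rw [← (IsAlgClosed.splits (minpoly K s)).eq_prod_roots_of_monic
    (minpoly.monic (Algebra.IsIntegral.isIntegral s)), minpoly.aeval, zero_mul, add_zero] at hab
  exact ⟨p, hab.symm⟩

theorem exists_aeval_surjective
    (h : ∀ m : Ideal A, m.IsMaximal → ∃ π ∈ m, m ≤ Ideal.span {π} ⊔ m ^ 2) :
    ∃ s : A, Function.Surjective (Polynomial.aeval (R := K) s) := by
  obtain ⟨s, l, hl, hs⟩ := exists_separating_generator (K := K) h
  exact ⟨s, aeval_surjective_of_forall_exists fun c =>
    exists_eq_algebraMap_add_mul (isMaximal_span_sub_algebraMap hl hs)⟩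

end Monogenic

section LinearForms

variable {ι R : Type*} [Fintype ι] [CommSemiring R]

/-- The linear form with coefficients `c`. -/
def linForm (c : ι → R) : MvPolynomial ι R := ∑ i, c i • X i

theorem isHomogeneous_linForm (c : ι → R) : (linForm c).IsHomogeneous 1 :=
  IsHomogeneous.sum _ _ _ fun i _ => smul_eq_C_mul (X i : MvPolynomial ι R) (c i) ▸
    isHomogeneous_C_mul_X _ _

theorem isHomogeneous_linForm_pow (c : ι → R) (d : ℕ) : (linForm c ^ d).IsHomogeneous d := by
  simpa only [one_mul] using (isHomogeneous_linForm c).pow d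

theorem exists_eq_linForm {L : MvPolynomial ι R} (hL : L.IsHomogeneous 1) :
    ∃ c, L = linForm c := by
  have hspan : L ∈ homogeneousSubmodule ι R 1 := hL
  rw [homogeneousSubmodule_one_eq_span_X, Submodule.mem_span_range_iff_exists_fun] at hspan
  obtain ⟨c, hc⟩ := hspan
  exact ⟨c, hc.symm⟩

theorem eval_linForm (c u : ι → R) : eval u (linForm c) = ∑ i, c i * u i := by
  simp [linForm, smul_eval]

theorem eval_linForm_dual [DecidableEq ι] (f : Module.Dual R (ι → R)) (u : ι → R) :
    eval u (linForm fun i => f (Pi.single i 1)) = f u := by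
  have hsum : u = ∑ i, u i • Pi.single i 1 := by
    ext j
    simp [Pi.single_apply]
  conv_rhs => rw [hsum]
  simp [eval_linForm, mul_comm]

theorem map_linForm {S : Type*} [CommSemiring S] (f : R →+* S) (c : ι → R) :
    map f (linForm c) = linForm (f ∘ c) := by
  simp [linForm, smul_eq_C_mul]

theorem map_coeff_linForm_pow {S : Type*} [CommSemiring S] (f : R →+* S) (c : ι → R) (d : ℕ)
    (m : ι →₀ ℕ) : f (coeff m (linForm c ^ d)) = coeff m (linForm (f ∘ c) ^ d) := by
  rw [← coeff_map, map_pow, map_linForm]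

theorem coeff_linForm_pow (c : ι → R) (m : ι →₀ ℕ) :
    coeff m (linForm c ^ m.degree) = m.multinomial * ∏ i, c i ^ m i := by
  rw [linForm, coeff_linearCombination_X_pow_of_fintype,
    if_pos (by rw [Finsupp.sum_fintype _ _ fun _ => rfl, Finsupp.degree_eq_sum]),
    Finsupp.prod_fintype _ _ fun _ => pow_zero _]

theorem natDegree_coeff_linForm_pow_le {f : ι → R[X]} {k : ℕ} (hf : ∀ i, (f i).natDegree ≤ k)
    (d : ℕ) (m : ι →₀ ℕ) : (coeff m (linForm f ^ d)).natDegree ≤ d * k := by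
  rcases eq_or_ne m.degree d with rfl | hm
  · rw [coeff_linForm_pow, ← nsmul_eq_mul]
    refine (Polynomial.natDegree_smul_le _ _).trans ((Polynomial.natDegree_prod_le _ _).trans ?_)
    rw [Finsupp.degree_eq_sum, Finset.sum_mul]
    exact Finset.sum_le_sum fun i _ => Polynomial.natDegree_pow_le_of_le _ (hf i)
  · rw [(isHomogeneous_linForm_pow f d).coeff_eq_zero hm, Polynomial.natDegree_zero]
    exact Nat.zero_le _

/-- `P` is a sum of `r` powers `L ^ d` of linear forms. -/
def IsSumOfPowers (r d : ℕ) (P : MvPolynomial ι R) : Prop :=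
  ∃ L : Fin r → MvPolynomial ι R, (∀ i, (L i).IsHomogeneous 1) ∧ P = ∑ i, L i ^ d

omit [Fintype ι] in
theorem isSumOfPowers_one_one {P : MvPolynomial ι R} (hP : P.IsHomogeneous 1) :
    IsSumOfPowers 1 1 P :=
  ⟨fun _ => P, fun _ => hP, by simp⟩

theorem isSumOfPowers_card {K α : Type*} [Field K] [IsAlgClosed K] {d : ℕ} (hd : 0 < d)
    (s : Finset α) (w : α → K) (c : α → ι → K) :
    IsSumOfPowers s.card d (∑ a ∈ s, w a • linForm (c a) ^ d) := by
  choose ρ hρ using fun a => IsAlgClosed.exists_pow_nat_eq (w a) hd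
  refine ⟨fun j => ρ (s.equivFin.symm j) • linForm (c (s.equivFin.symm j)), fun j => ?_, ?_⟩
  · exact (homogeneousSubmodule ι K 1).smul_mem _ (isHomogeneous_linForm _)
  · rw [← s.sum_coe_sort, ← s.equivFin.symm.sum_comp]
    simp only [smul_pow, hρ]

end LinearForms

section DualForm

variable {ι K A : Type*} [Fintype ι] [CommRing K] [CommRing A] [Algebra K A]

/-- `P` arises from the `d`-th power of the linear form over the `K`-algebra `A` with coefficients
`y` by applying the functional `φ` to each coefficient. For `A = K ^ r` such forms are the
combinations of `r` `d`-th powers of linear forms over `K`; in general they are the forms in the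
linear span of the Veronese image of `Spec A`. -/
def IsDualForm (φ : A →ₗ[K] K) (y : ι → A) (d : ℕ) (P : MvPolynomial ι K) : Prop :=
  ∀ m, coeff m P = φ (coeff m (linForm y ^ d))

namespace IsDualForm

variable {φ : A →ₗ[K] K} {y y' : ι → A} {d : ℕ} {P : MvPolynomial ι K}

theorem of_forall_degree_eq (hP : P.IsHomogeneous d)
    (h : ∀ m : ι →₀ ℕ, m.degree = d → coeff m P = φ (coeff m (linForm y ^ d))) :
    IsDualForm φ y d P := fun m => by
  by_cases hm : m.degree = d
  · exact h m hm
  · rw [hP.coeff_eq_zero hm, (isHomogeneous_linForm_pow y d).coeff_eq_zero hm, map_zero]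

theorem isHomogeneous (h : IsDualForm φ y d P) : P.IsHomogeneous d := by
  intro m hm
  contrapose! hm
  rw [h, (isHomogeneous_linForm_pow y d).coeff_eq_zero, map_zero]
  rwa [show m.degree = Finsupp.weight 1 m from DFunLike.congr_fun Finsupp.degree_eq_weight_one m]

theorem congr_of_sub_mem (h : IsDualForm φ y d P) (hy : ∀ i, y i - y' i ∈ apolarIdeal φ) :
    IsDualForm φ y' d P := fun m => by
  have hmk : Ideal.Quotient.mk (apolarIdeal φ) ∘ y = Ideal.Quotient.mk (apolarIdeal φ) ∘ y' :=
    funext fun i => Ideal.Quotient.eq.2 (hy i)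
  have hmem : coeff m (linForm y ^ d) - coeff m (linForm y' ^ d) ∈ apolarIdeal φ := by
    rw [← Ideal.Quotient.eq, map_coeff_linForm_pow, map_coeff_linForm_pow, hmk]
  have := hmem 1
  rwa [mul_one, map_sub, ← h, sub_eq_zero] at this

theorem lift {B : Type*} [CommRing B] [Algebra K B] {f : B →ₐ[K] A} {x : ι → B}
    (h : IsDualForm φ (f ∘ x) d P) : IsDualForm (φ ∘ₗ f.toLinearMap) x d P := fun m => by
  rw [h m]
  exact congrArg φ (map_coeff_linForm_pow (f : B →+* A) x d m).symm

theorem eq_sum_smul_linForm_pow {Φ : K[X] →ₗ[K] K} {f : ι → K[X]} {k : ℕ}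
    (h : IsDualForm Φ f d P) (hf : ∀ i, (f i).natDegree ≤ k) {s : Finset K} {w : K → K}
    (hΦ : ∀ q : K[X], q.natDegree ≤ d * k → Φ q = ∑ α ∈ s, q.eval α * w α) :
    P = ∑ α ∈ s, w α • linForm (fun i => (f i).eval α) ^ d := by
  ext m
  rw [h m, hΦ _ (natDegree_coeff_linForm_pow_le hf d m), coeff_sum]
  refine Finset.sum_congr rfl fun α _ => ?_
  rw [coeff_smul, smul_eq_mul, mul_comm, ← Polynomial.coe_evalRingHom, map_coeff_linForm_pow]
  rfl

end IsDualForm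

end DualForm

section Apolarity

variable {ι K A : Type*} [Fintype ι] [Field K] [IsAlgClosed K] [CharZero K] [CommRing A]
  [Algebra K A] {d : ℕ} {P : MvPolynomial ι K}

theorem IsDualForm.isSumOfPowers_of_natDegree_eq {Φ : K[X] →ₗ[K] K} {f : ι → K[X]} {g : K[X]}
    {k : ℕ} (h : IsDualForm Φ f d P) (hd : 2 ≤ d) (hΦ : apolarIdeal Φ = Ideal.span {g})
    (hmonic : g.Monic) (hg : g.natDegree = k + 1) : IsSumOfPowers (k * (d - 1) + 1) d P := by
  have hdeg (i) : (f i %ₘ g).natDegree ≤ k := by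
    have := Polynomial.natDegree_modByMonic_lt (f i) hmonic fun h1 => by simp [h1] at hg
    omega
  have hmod : IsDualForm Φ (fun i => f i %ₘ g) d P := h.congr_of_sub_mem fun i => by
    rw [hΦ, Ideal.mem_span_singleton]
    exact ⟨f i /ₘ g, by linear_combination -Polynomial.modByMonic_add_div (f i) g⟩
  obtain ⟨δ, rfl⟩ := Nat.exists_eq_add_of_le' hd
  change IsSumOfPowers (k * (δ + 1) + 1) _ _
  obtain ⟨s, w, hs, hquad⟩ := exists_apply_eq_sum_eval (e := k * (δ + 1) + 1) hΦ hmonic hg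
    (by nlinarith)
  rw [hmod.eq_sum_smul_linForm_pow hdeg fun q hq => hquad q ?_, ← hs]
  · exact isSumOfPowers_card (by omega) s w _
  · refine Polynomial.degree_le_natDegree.trans_lt (Nat.cast_lt.2 (hq.trans_lt ?_))
    linarith

theorem IsDualForm.exists_isSumOfPowers [Module.Finite K A] {φ : A →ₗ[K] K} {y : ι → A}
    (h : IsDualForm φ y d P) (hd : 1 ≤ d) (hP : P ≠ 0)
    (hA : ∀ m : Ideal A, m.IsMaximal → ∃ π ∈ m, m ≤ Ideal.span {π} ⊔ m ^ 2) :
    ∃ k, k + 1 ≤ Module.finrank K A ∧ IsSumOfPowers (k * (d - 1) + 1) d P := by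
  obtain ⟨s, hs⟩ := exists_aeval_surjective (K := K) hA
  obtain ⟨f, rfl⟩ : ∃ f : ι → K[X], Polynomial.aeval s ∘ f = y := hs.comp_left y
  replace h := h.lift
  set Φ := φ ∘ₗ (Polynomial.aeval s).toLinearMap
  have hmin : minpoly K s ∈ apolarIdeal Φ := fun q => by simp [Φ]
  have hmin0 : minpoly K s ≠ 0 := minpoly.ne_zero (Algebra.IsIntegral.isIntegral s)
  obtain ⟨g, hmonic, hΦ⟩ := exists_monic_eq_span_singleton
    ((apolarIdeal Φ).ne_bot_iff.2 ⟨_, hmin, hmin0⟩)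
  have hle : g.natDegree ≤ Module.finrank K A :=
    (Polynomial.natDegree_le_of_dvd (Ideal.mem_span_singleton.1 (hΦ ▸ hmin)) hmin0).trans
      (minpoly.natDegree_le s)
  obtain ⟨k, hk⟩ : ∃ k, g.natDegree = k + 1 := by
    refine Nat.exists_eq_succ_of_ne_zero fun h0 => hP (MvPolynomial.ext _ _ fun m => ?_)
    have hmem : (1 : K[X]) ∈ apolarIdeal Φ := by
      rw [hΦ, hmonic.natDegree_eq_zero.1 h0]
      exact Ideal.mem_span_singleton_self 1
    rw [h m, ← one_mul (coeff m (linForm f ^ d)), hmem, coeff_zero]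
  rcases hd.eq_or_lt with rfl | hd2
  · exact ⟨0, by omega, isSumOfPowers_one_one h.isHomogeneous⟩
  · exact ⟨k, hk ▸ hle, h.isSumOfPowers_of_natDegree_eq hd2 hΦ hmonic hk⟩

end Apolarity

section Homogenization

theorem homogeneousComponent_mul_of_isHomogeneous {σ R : Type*} [CommSemiring R] {i : ℕ}
    {F : MvPolynomial σ R} (hF : F.IsHomogeneous i) (G : MvPolynomial σ R) (j : ℕ) :
    homogeneousComponent j (F * G) = if i ≤ j then F * homogeneousComponent (j - i) G else 0 := by
  let _ := gradedAlgebra (σ := σ) (R := R)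
  simp only [← decomposition.decompose'_apply]
  exact DirectSum.coe_decompose_mul_of_left_mem (𝒜 := homogeneousSubmodule σ R) j hF

variable {σ R : Type*} [CommSemiring R]

/-- The part of degree at most `N` of a polynomial, made homogeneous of degree `N` with the help of
the linear form `l`. -/
def homogenization (l : MvPolynomial σ R) (N : ℕ) : MvPolynomial σ R →ₗ[R] MvPolynomial σ R :=
  ∑ j ∈ Finset.range (N + 1), LinearMap.mulLeft R (l ^ (N - j)) ∘ₗ homogeneousComponent j

theorem homogenization_apply (l : MvPolynomial σ R) (N : ℕ) (F : MvPolynomial σ R) :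
    homogenization l N F =
      ∑ j ∈ Finset.range (N + 1), l ^ (N - j) * homogeneousComponent j F := by
  simp [homogenization]

theorem homogenization_zero (l F : MvPolynomial σ R) :
    homogenization l 0 F = homogeneousComponent 0 F := by
  simp [homogenization]

theorem homogenization_succ (l : MvPolynomial σ R) (N : ℕ) (F : MvPolynomial σ R) :
    homogenization l (N + 1) F = l * homogenization l N F + homogeneousComponent (N + 1) F := by
  rw [homogenization_apply, homogenization_apply, Finset.sum_range_succ, Finset.mul_sum]
  simp only [Nat.sub_self, pow_zero, one_mul, ← mul_assoc, ← pow_succ']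
  refine congrArg (· + _) (Finset.sum_congr rfl fun j hj => ?_)
  rw [Nat.sub_add_comm (Finset.mem_range_succ_iff.1 hj)]

variable {l : MvPolynomial σ R}

theorem isHomogeneous_homogenization (hl : l.IsHomogeneous 1) (N : ℕ) (F : MvPolynomial σ R) :
    (homogenization l N F).IsHomogeneous N := by
  rw [homogenization_apply]
  refine IsHomogeneous.sum _ _ _ fun j hj => ?_
  have hmul := (hl.pow (N - j)).mul (homogeneousComponent_isHomogeneous j F)
  rwa [one_mul, Nat.sub_add_cancel (Finset.mem_range_succ_iff.1 hj)] at hmul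

theorem homogenization_add_of_isHomogeneous {t : ℕ} {F : MvPolynomial σ R}
    (hF : F.IsHomogeneous t) (m : ℕ) : homogenization l (t + m) F = l ^ m * F := by
  simp only [homogenization_apply, homogeneousComponent_of_mem hF, mul_ite, mul_zero]
  rw [Finset.sum_ite_eq', if_pos (by simp), Nat.add_sub_cancel_left]

theorem homogenization_sub_one_mul {R : Type*} [CommRing R] {l : MvPolynomial σ R}
    (hl : l.IsHomogeneous 1) (N : ℕ) (H : MvPolynomial σ R) :
    homogenization l N ((l - 1) * H) = -homogeneousComponent N H := by
  simp only [sub_mul, one_mul]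
  induction N with
  | zero =>
    rw [homogenization_zero, map_sub, homogeneousComponent_mul_of_isHomogeneous hl,
      if_neg one_pos.not_ge, zero_sub]
  | succ N ih =>
    rw [homogenization_succ, ih, map_sub, homogeneousComponent_mul_of_isHomogeneous hl,
      if_pos (Nat.le_add_left 1 N), Nat.add_sub_cancel]
    ring

theorem map_homogenization {S : Type*} [CommSemiring S] (f : MvPolynomial σ R →+* S) (hf : f l = 1)
    {F : MvPolynomial σ R} {N : ℕ} (hF : F.totalDegree ≤ N) : f (homogenization l N F) = f F := by
  conv_rhs => rw [← sum_homogeneousComponent F]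
  simp only [homogenization_apply, map_sum, map_mul, map_pow, hf, one_pow, one_mul]
  symm
  refine Finset.sum_subset (Finset.range_subset_range.2 (Nat.succ_le_succ hF)) fun j _ hj => ?_
  rw [homogeneousComponent_eq_zero _ _ (by simpa using hj), map_zero]

end Homogenization

namespace ProjSubscheme

section Affine

variable {σ : Type*}

/-- The ideal of the affine scheme `Z ∩ {l = 1}`. -/
def affineIdeal (Z : ProjSubscheme σ) (l : MvPolynomial σ ℂ) : Ideal (MvPolynomial σ ℂ) :=
  Z.ideal ⊔ Ideal.span {l - 1}

/-- The coordinate ring of the affine scheme `Z ∩ {l = 1}`. -/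
abbrev AffineRing (Z : ProjSubscheme σ) (l : MvPolynomial σ ℂ) : Type _ :=
  MvPolynomial σ ℂ ⧸ Z.affineIdeal l

/-- Restriction of polynomials to `Z ∩ {l = 1}`. -/
def restr (Z : ProjSubscheme σ) (l : MvPolynomial σ ℂ) : MvPolynomial σ ℂ →ₐ[ℂ] Z.AffineRing l :=
  Ideal.Quotient.mkₐ ℂ (Z.affineIdeal l)

variable (Z : ProjSubscheme σ) {l : MvPolynomial σ ℂ}

theorem restr_eq_zero_iff (F : MvPolynomial σ ℂ) : Z.restr l F = 0 ↔ F ∈ Z.affineIdeal l :=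
  Ideal.Quotient.eq_zero_iff_mem

theorem restr_surjective : Function.Surjective (Z.restr l) :=
  Ideal.Quotient.mkₐ_surjective ℂ _

theorem restr_of_mem {F : MvPolynomial σ ℂ} (hF : F ∈ Z.ideal) : Z.restr l F = 0 :=
  (Z.restr_eq_zero_iff F).2 (Ideal.mem_sup_left hF)

theorem restr_self : Z.restr l l = 1 := by
  rw [← sub_eq_zero, ← map_one (Z.restr l), ← map_sub, restr_eq_zero_iff]
  exact Ideal.mem_sup_right (Ideal.mem_span_singleton_self _)

theorem homogenization_mem {F : MvPolynomial σ ℂ} (hF : F ∈ Z.ideal) (N : ℕ) :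
    homogenization l N F ∈ Z.ideal := by
  rw [homogenization_apply]
  exact sum_mem fun j _ => Z.ideal.mul_mem_left _ (Z.homogeneous F hF j)

theorem mem_ideal_of_pow_mul_mem (hreg : ∀ G, l * G ∈ Z.ideal → G ∈ Z.ideal) {m : ℕ}
    {F : MvPolynomial σ ℂ} (h : l ^ m * F ∈ Z.ideal) : F ∈ Z.ideal := by
  induction m with
  | zero => rwa [pow_zero, one_mul] at h
  | succ m ih => exact ih (hreg _ (by rwa [pow_succ', mul_assoc] at h))

theorem mem_ideal_of_restr_eq_zero (hl : l.IsHomogeneous 1)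
    (hreg : ∀ G, l * G ∈ Z.ideal → G ∈ Z.ideal) {t : ℕ} {F : MvPolynomial σ ℂ}
    (hF : F.IsHomogeneous t) (h : Z.restr l F = 0) : F ∈ Z.ideal := by
  rw [restr_eq_zero_iff] at h
  obtain ⟨G, hG, _, hH, rfl⟩ := Submodule.mem_sup.1 h
  obtain ⟨H, rfl⟩ := Ideal.mem_span_singleton.1 hH
  refine Z.mem_ideal_of_pow_mul_mem hreg (m := H.totalDegree + 1) ?_
  rw [← homogenization_add_of_isHomogeneous hF, map_add,
    homogenization_sub_one_mul hl, homogeneousComponent_eq_zero _ _ (by omega), neg_zero, add_zero]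
  exact Z.homogenization_mem hG _

theorem exists_isHomogeneous_restr_eq (hl : l.IsHomogeneous 1) {F : MvPolynomial σ ℂ} {t : ℕ}
    (ht : F.totalDegree ≤ t) : ∃ G, G.IsHomogeneous t ∧ Z.restr l G = Z.restr l F :=
  ⟨homogenization l t F, isHomogeneous_homogenization hl t F,
    map_homogenization (Z.restr l : _ →+* Z.AffineRing l) Z.restr_self ht⟩

theorem finrank_map_restr_le [Finite σ] (t : ℕ) :
    Module.finrank ℂ ((homogeneousSubmodule σ ℂ t).map (Z.restr l).toLinearMap) ≤
      Z.hilbertFunction t := by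
  have : Module.Finite ℂ (homogeneousSubmodule σ ℂ t) :=
    Module.Finite.iff_fg.2 (homogeneousSubmodule_fg σ ℂ t)
  let f := ((Z.ideal.restrictScalars ℂ).submoduleOf (homogeneousSubmodule σ ℂ t)).liftQ
    ((Z.restr l).toLinearMap ∘ₗ (homogeneousSubmodule σ ℂ t).subtype)
    fun F hF => LinearMap.mem_ker.2 (Z.restr_of_mem hF)
  have hrange : (homogeneousSubmodule σ ℂ t).map (Z.restr l).toLinearMap = LinearMap.range f := by
    rw [Submodule.range_liftQ, LinearMap.range_comp, Submodule.range_subtype]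
  rw [hrange]
  exact LinearMap.finrank_range_le f

theorem rank_affineRing_le [Finite σ] (hl : l.IsHomogeneous 1) {k : ℕ}
    (hZ : Z.IsZeroDimOfDegree k) : Module.rank ℂ (Z.AffineRing l) ≤ k := by
  obtain ⟨t₀, ht₀⟩ := eventually_atTop.1 hZ
  refine rank_le fun s hs => ?_
  choose F hF using Z.restr_surjective (l := l)
  set t := max t₀ (s.sup fun a => (F a).totalDegree)
  set V := (homogeneousSubmodule σ ℂ t).map (Z.restr l).toLinearMap
  have : Module.Finite ℂ V := Module.Finite.iff_fg.2 ((homogeneousSubmodule_fg σ ℂ t).map _)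
  have hmem (a : s) : a.1 ∈ V := by
    obtain ⟨G, hG, hGF⟩ := Z.exists_isHomogeneous_restr_eq hl (F := F a.1) (t := t)
      ((Finset.le_sup (f := fun a => (F a).totalDegree) a.2).trans (le_max_right _ _))
    exact ⟨G, hG, hGF.trans (hF a.1)⟩
  have hli : LinearIndependent ℂ fun a : s => (⟨a.1, hmem a⟩ : V) :=
    LinearIndependent.of_comp V.subtype hs
  calc s.card = Fintype.card s := (Fintype.card_coe s).symm
    _ ≤ Module.finrank ℂ V := hli.fintype_card_le_finrank
    _ ≤ Z.hilbertFunction t := Z.finrank_map_restr_le t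
    _ = k := ht₀ t (le_max_left _ _)

theorem exists_dual_restr_eq [Finite σ] (hl : l.IsHomogeneous 1)
    (hreg : ∀ G, l * G ∈ Z.ideal → G ∈ Z.ideal) {v : σ → ℂ} (hv : v ∈ Z.span) :
    ∃ φ : Module.Dual ℂ (Z.AffineRing l), ∀ i, φ (Z.restr l (X i)) = v i := by
  cases nonempty_fintype σ
  let f : (σ → ℂ) →ₗ[ℂ] Z.AffineRing l :=
    Fintype.linearCombination ℂ fun i => Z.restr l (X i)
  have hf (c : σ → ℂ) : f c = Z.restr l (linForm c) := by
    simp [f, Fintype.linearCombination_apply, linForm]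
  have hker : Fintype.linearCombination ℂ v ∈ (LinearMap.ker f).dualAnnihilator := by
    refine (Submodule.mem_dualAnnihilator _).2 fun c hc => ?_
    rw [LinearMap.mem_ker, hf] at hc
    have hmem := Z.mem_ideal_of_restr_eq_zero hl hreg (isHomogeneous_linForm c) hc
    simpa [eval_linForm, Fintype.linearCombination_apply] using
      hv _ hmem (isHomogeneous_linForm c)
  rw [← LinearMap.range_dualMap_eq_dualAnnihilator_ker] at hker
  obtain ⟨φ, hφ⟩ := hker
  classical
  exact ⟨φ, fun i => by simpa [f] using LinearMap.congr_fun hφ (Pi.single i 1)⟩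

end Affine

end ProjSubscheme

section PointDerivation

variable {K A : Type*} [Field K] [CommRing A] [Algebra K A]

/-- The derivations `A → K` at the `K`-point `ε` of `Spec A`, that is, the Zariski tangent vectors
at this point. -/
def pointDerivation (ε : A →ₐ[K] K) : Submodule K (Module.Dual K A) where
  carrier := {θ | ∀ a b, θ (a * b) = ε a * θ b + ε b * θ a}
  add_mem' {θ θ'} hθ hθ' a b := by
    simp only [LinearMap.add_apply, hθ a b, hθ' a b]
    ring
  zero_mem' a b := by simp
  smul_mem' c θ hθ a b := by
    simp only [LinearMap.smul_apply, smul_eq_mul, hθ a b]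
    ring

variable {ε : A →ₐ[K] K}

theorem apply_one_of_mem_pointDerivation {θ : A →ₗ[K] K} (hθ : θ ∈ pointDerivation ε) :
    θ 1 = 0 := by
  simpa using hθ 1 1

theorem exists_mem_pointDerivation_ne_zero {J : Ideal A} (hJ : RingHom.ker ε ^ 2 ≤ J)
    (hJε : J ≤ RingHom.ker ε) {p : A} (hp : p ∈ RingHom.ker ε) (hpJ : p ∉ J) :
    ∃ θ ∈ pointDerivation ε, (∀ a ∈ J, θ a = 0) ∧ θ p ≠ 0 := by
  obtain ⟨ψ, hψp, hψJ⟩ := Submodule.exists_le_ker_of_notMem (p := J.restrictScalars K) hpJ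
  let θ : A →ₗ[K] K := ψ ∘ₗ (LinearMap.id - (Algebra.linearMap K A).comp ε.toLinearMap)
  have hθ (a : A) : θ a = ψ (a - algebraMap K A (ε a)) := rfl
  have hθker {a : A} (ha : a ∈ RingHom.ker ε) : θ a = ψ a := by
    rw [hθ, (RingHom.mem_ker).1 ha, map_zero, sub_zero]
  refine ⟨θ, fun a b => ?_, fun a ha => (hθker (hJε ha)).trans (hψJ ha), (hθker hp).trans_ne hψp⟩
  have hsub (a : A) : a - algebraMap K A (ε a) ∈ RingHom.ker ε := by simp [RingHom.mem_ker]
  have hmul : ψ ((a - algebraMap K A (ε a)) * (b - algebraMap K A (ε b))) = 0 :=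
    hψJ (hJ (sq (RingHom.ker ε) ▸ Ideal.mul_mem_mul (hsub a) (hsub b)))
  have hexpand : a * b - algebraMap K A (ε (a * b)) =
      (a - algebraMap K A (ε a)) * (b - algebraMap K A (ε b)) +
        ε a • (b - algebraMap K A (ε b)) + ε b • (a - algebraMap K A (ε a)) := by
    rw [Algebra.smul_def, Algebra.smul_def, map_mul, map_mul]
    ring
  simp only [hθ, hexpand, map_add, map_smul, hmul, zero_add, smul_eq_mul]

theorem exists_ker_le_span_sup_sq (h : (pointDerivation ε).IsPrincipal) :
    ∃ π ∈ RingHom.ker ε, RingHom.ker ε ≤ Ideal.span {π} ⊔ RingHom.ker ε ^ 2 := by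
  have hsq : RingHom.ker ε ^ 2 ≤ RingHom.ker ε := Ideal.pow_le_self two_ne_zero
  by_cases hle : RingHom.ker ε ≤ RingHom.ker ε ^ 2
  · exact ⟨0, Ideal.zero_mem _, hle.trans le_sup_right⟩
  obtain ⟨π, hπ, hπ2⟩ := SetLike.not_le_iff_exists.1 hle
  refine ⟨π, hπ, fun p hp => ?_⟩
  by_contra hpJ
  obtain ⟨θ, hθ, -, hθπ⟩ := exists_mem_pointDerivation_ne_zero le_rfl hsq hπ hπ2
  obtain ⟨θ', hθ', hJ, hθ'p⟩ := exists_mem_pointDerivation_ne_zero le_sup_right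
    (sup_le ((Ideal.span_singleton_le_iff_mem _).2 hπ) hsq) hp hpJ
  obtain ⟨θ₀, hθ₀⟩ := h.principal
  rw [hθ₀, Submodule.mem_span_singleton] at hθ hθ'
  obtain ⟨c, rfl⟩ := hθ
  obtain ⟨c', rfl⟩ := hθ'
  rcases mul_eq_zero.1 (hJ π (Ideal.mem_sup_left (Ideal.mem_span_singleton_self π))) with h0 | h0
  · exact hθ'p (by rw [LinearMap.smul_apply, h0, zero_smul])
  · exact hθπ (by rw [LinearMap.smul_apply, h0, smul_zero])

end PointDerivation

section Differential

variable {σ R : Type*} [Fintype σ] [CommRing R]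

/-- The differential of a polynomial at the point `v`. -/
def differential (v : σ → R) (F : MvPolynomial σ R) : (σ → R) →ₗ[R] R :=
  ∑ i, eval v (pderiv i F) • LinearMap.proj i

theorem differential_apply (v w : σ → R) (F : MvPolynomial σ R) :
    differential v F w = ∑ i, eval v (pderiv i F) * w i := by
  simp [differential]

theorem differential_X (v : σ → R) (i : σ) : differential v (X i) = LinearMap.proj i := by
  classical
  ext j
  simp [differential_apply, pderiv_X, Pi.single_apply]

theorem differential_add (v : σ → R) (F G : MvPolynomial σ R) :
    differential v (F + G) = differential v F + differential v G := by
  simp [differential, add_smul, Finset.sum_add_distrib]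

theorem differential_mul (v : σ → R) (F G : MvPolynomial σ R) :
    differential v (F * G) = eval v F • differential v G + eval v G • differential v F := by
  simp [differential, add_smul, Finset.sum_add_distrib, Finset.smul_sum, smul_smul]

theorem differential_linForm (c v w : σ → R) :
    differential v (linForm c) w = eval w (linForm c) := by
  classical
  simp [differential_apply, linForm, pderiv_X, Pi.single_apply, smul_eval]

theorem differential_self_of_isHomogeneous {F : MvPolynomial σ R} {t : ℕ} (hF : F.IsHomogeneous t)
    (v : σ → R) : differential v F v = t * eval v F := by
  have h := congrArg (eval v) hF.sum_X_mul_pderiv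
  simp only [map_sum, map_mul, eval_X, nsmul_eq_mul, map_natCast] at h
  simp only [differential_apply, ← h, mul_comm]

theorem apply_eq_differential_of_mem_pointDerivation {K A : Type*} [Field K] [CommRing A]
    [Algebra K A] {ε : A →ₐ[K] K} {θ : A →ₗ[K] K} (hθ : θ ∈ pointDerivation ε)
    (ρ : MvPolynomial σ K →ₐ[K] A) (F : MvPolynomial σ K) :
    θ (ρ F) = differential (fun i => ε (ρ (X i))) F fun i => θ (ρ (X i)) := by
  have hε (G : MvPolynomial σ K) : ε (ρ G) = eval (fun i => ε (ρ (X i))) G :=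
    DFunLike.congr_fun (aeval_unique (ε.comp ρ)) G
  induction F using MvPolynomial.induction_on with
  | C z =>
    rw [← algebraMap_eq, AlgHom.commutes, Algebra.algebraMap_eq_smul_one, map_smul,
      apply_one_of_mem_pointDerivation hθ]
    simp [differential_apply]
  | add p q hp hq => rw [map_add, map_add, hp, hq, differential_add, LinearMap.add_apply]
  | mul_X p i hp =>
    rw [map_mul, hθ, hε, hp, differential_mul, differential_X, eval_X]
    simp

end Differential

namespace ProjSubscheme

section Curvilinear

variable {σ : Type*} [Fintype σ] {Z : ProjSubscheme σ} {l : MvPolynomial σ ℂ}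

theorem mkQ_mem_tangentSpace {v w : σ → ℂ} (h : ∀ F ∈ Z.ideal, differential v F w = 0) :
    (Submodule.span ℂ {v}).mkQ w ∈ Z.tangentSpace v := by
  refine Submodule.mem_map_of_mem ?_
  simp only [Submodule.mem_iInf]
  exact h

omit [Fintype σ] in
theorem apply_restr_eq_eval (ε : Z.AffineRing l →ₐ[ℂ] ℂ) (F : MvPolynomial σ ℂ) :
    ε (Z.restr l F) = eval (fun i => ε (Z.restr l (X i))) F :=
  DFunLike.congr_fun (aeval_unique (ε.comp (Z.restr l))) F

omit [Fintype σ] in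
theorem hasPoint_apply_restr_X (hl : l.IsHomogeneous 1) (ε : Z.AffineRing l →ₐ[ℂ] ℂ) :
    Z.HasPoint fun i => ε (Z.restr l (X i)) := by
  refine ⟨fun h => ?_, fun F hF => ?_⟩
  · have hεl := Z.apply_restr_eq_eval ε l
    have hl0 : constantCoeff l = 0 := hl.coeff_eq_zero (by simp)
    rw [Z.restr_self, map_one, h, eval_zero, hl0] at hεl
    exact one_ne_zero hεl
  · rw [← Z.apply_restr_eq_eval, Z.restr_of_mem hF, map_zero]

theorem finrank_pointDerivation_le (hl : l.IsHomogeneous 1) (ε : Z.AffineRing l →ₐ[ℂ] ℂ) :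
    Module.finrank ℂ (pointDerivation ε) ≤
      Module.finrank ℂ (Z.tangentSpace fun i => ε (Z.restr l (X i))) := by
  set v : σ → ℂ := fun i => ε (Z.restr l (X i))
  have hdiff (θ : pointDerivation ε) (F : MvPolynomial σ ℂ) :
      θ.1 (Z.restr l F) = differential v F fun i => θ.1 (Z.restr l (X i)) :=
    apply_eq_differential_of_mem_pointDerivation θ.2 (Z.restr l) F
  let T : pointDerivation ε →ₗ[ℂ] Z.tangentSpace v := LinearMap.codRestrict _
    ((Submodule.span ℂ {v}).mkQ ∘ₗ LinearMap.pi fun i =>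
      (LinearMap.applyₗ (Z.restr l (X i))).comp (Submodule.subtype _))
    fun θ => mkQ_mem_tangentSpace fun F hF =>
      (hdiff θ F).symm.trans (by rw [Z.restr_of_mem hF, map_zero])
  refine LinearMap.finrank_le_finrank_of_injective (f := T)
    ((injective_iff_map_eq_zero T).2 fun θ hθ => ?_)
  obtain ⟨z, hz⟩ : ∃ z : ℂ, z • v = fun i => θ.1 (Z.restr l (X i)) :=
    Submodule.mem_span_singleton.1
      ((Submodule.Quotient.mk_eq_zero _).1 (congrArg Subtype.val hθ))
  have hz0 : z = 0 := by
    have hθl := hdiff θ l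
    rw [← hz, map_smul, differential_self_of_isHomogeneous hl, ← Z.apply_restr_eq_eval,
      Z.restr_self, apply_one_of_mem_pointDerivation θ.2, map_one] at hθl
    simpa using hθl.symm
  refine Subtype.ext (LinearMap.ext fun a => ?_)
  obtain ⟨F, rfl⟩ := Z.restr_surjective a
  rw [hdiff, ← hz, hz0, zero_smul, map_zero]
  rfl

theorem IsCurvilinear.exists_le_span_sup_sq (hZ : Z.IsCurvilinear) (hl : l.IsHomogeneous 1)
    [Module.Finite ℂ (Z.AffineRing l)] (m : Ideal (Z.AffineRing l)) [m.IsMaximal] :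
    ∃ π ∈ m, m ≤ Ideal.span {π} ⊔ m ^ 2 := by
  obtain ⟨ε, rfl⟩ := exists_algHom_ker_eq (K := ℂ) m
  exact exists_ker_le_span_sup_sq ((Submodule.finrank_le_one_iff_isPrincipal _).1
    ((finrank_pointDerivation_le hl ε).trans (hZ _ (hasPoint_apply_restr_X hl ε))))

end Curvilinear

end ProjSubscheme

theorem exists_forall_sum_eval_smul_notMem {K V α σ ι : Type*} [Field K] [Infinite K]
    [AddCommGroup V] [Module K V] [Fintype α] (p : α → MvPolynomial σ K) (v : α → V) {S : Set ι}
    (hS : S.Finite) (W : ι → Submodule K V) (h : ∀ j ∈ S, ∃ c, ∑ a, eval c (p a) • v a ∉ W j) :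
    ∃ c, ∀ j ∈ S, ∑ a, eval c (p a) • v a ∉ W j := by
  have hpoly : ∀ j ∈ S, ∃ q : MvPolynomial σ K, q ≠ 0 ∧
      ∀ c, ∑ a, eval c (p a) • v a ∈ W j → eval c q = 0 := fun j hj => by
    obtain ⟨c₀, hc₀⟩ := h j hj
    obtain ⟨θ, hθ, hW⟩ := Submodule.exists_le_ker_of_notMem hc₀
    have heval (c) : eval c (∑ a, θ (v a) • p a) = θ (∑ a, eval c (p a) • v a) := by
      simp [smul_eval, mul_comm]
    exact ⟨_, fun h0 => hθ (by rw [← heval, h0, map_zero]), fun c hc => (heval c).trans (hW hc)⟩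
  choose! q hq0 hq using hpoly
  have hprod : ∏ j ∈ hS.toFinset, q j ≠ 0 :=
    Finset.prod_ne_zero_iff.2 fun j hj => hq0 j (hS.mem_toFinset.1 hj)
  obtain ⟨c, hc⟩ : ∃ c, eval c (∏ j ∈ hS.toFinset, q j) ≠ 0 := by
    by_contra! h
    exact hprod (MvPolynomial.funext fun c => by rw [h c, map_zero])
  rw [map_prod, Finset.prod_ne_zero_iff] at hc
  exact ⟨c, fun j hj hmem => hc j (hS.mem_toFinset.2 hj) (hq j hj c hmem)⟩

theorem ProjSubscheme.exists_X_notMem_of_mem_associatedPrimes {σ : Type*} [Finite σ]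
    (Z : ProjSubscheme σ) {Q : Ideal (MvPolynomial σ ℂ)}
    (hQ : Q ∈ associatedPrimes (MvPolynomial σ ℂ) (MvPolynomial σ ℂ ⧸ Z.ideal)) :
    ∃ i, X i ∉ Q := by
  obtain ⟨hprime, x, hx⟩ := isAssociatedPrime_iff.1 hQ
  obtain ⟨F, rfl⟩ := Ideal.Quotient.mk_surjective x
  have hmem (G : MvPolynomial σ ℂ) : G ∈ Q ↔ G * F ∈ Z.ideal := by
    rw [hx, Submodule.mem_colon_singleton, Submodule.mem_bot, ← Ideal.Quotient.eq_zero_iff_mem,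
      map_mul]
    rfl
  by_contra! h
  have hF : F ∈ Z.ideal := Z.saturated F fun i => (hmem _).1 (h i)
  exact hprime.ne_top ((Ideal.eq_top_iff_one _).2 ((hmem 1).2 (by rwa [one_mul])))

section Veronese

variable {n d : ℕ}

theorem Expo.sum_eq (a : Expo n d) : ∑ i, a.1 i = d :=
  (Finset.mem_finsuppAntidiag.1 a.2).1

theorem Expo.degree_eq (a : Expo n d) : a.1.degree = d := by
  rw [Finsupp.degree_eq_sum, a.sum_eq]

theorem Expo.multinomial_ne_zero (a : Expo n d) : (a.1.multinomial : ℂ) ≠ 0 := by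
  rw [Finsupp.multinomial_eq]
  exact_mod_cast (Nat.multinomial_pos _ _).ne'

theorem eval_eq_sum_expo {G : MvPolynomial (Fin (n + 1)) ℂ} (hG : G.IsHomogeneous d)
    (u : Fin (n + 1) → ℂ) : eval u G = ∑ a : Expo n d, coeff a.1 G * ∏ i, u i ^ a.1 i := by
  rw [eval_eq', Finset.sum_coe_sort _ fun m => coeff m G * ∏ i, u i ^ m i]
  refine Finset.sum_subset (fun m hm => ?_) fun m _ hm => by
    rw [notMem_support_iff.1 hm, zero_mul]
  refine Finset.mem_finsuppAntidiag.2 ⟨?_, Finset.subset_univ _⟩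
  rw [← Finsupp.degree_eq_sum]
  by_contra hmd
  exact mem_support_iff.1 hm (hG.coeff_eq_zero hmd)

theorem coords_linForm_pow (u : Fin (n + 1) → ℂ) (a : Expo n d) :
    coords n d (linForm u ^ d) a = a.1.multinomial * ∏ i, u i ^ a.1 i := by
  rw [← coeff_linForm_pow, a.degree_eq, coords]

theorem InVeronese.mem_ideal {Z : ProjSubscheme (Expo n d)} (hZ : InVeronese Z)
    {F : MvPolynomial (Expo n d) ℂ} (hF : ∀ u, eval (coords n d (linForm u ^ d)) F = 0) :
    F ∈ Z.ideal := by
  refine hZ (mem_vanishingIdeal_iff.2 ?_)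
  rintro v ⟨L, hL, rfl⟩
  obtain ⟨c, rfl⟩ := exists_eq_linForm hL
  exact hF c

/-- The linear form on the space of forms of degree `d` that takes the value `G(u)` at the `d`-th
power of the linear form with coefficients `u`. -/
def hyperplaneForm (d : ℕ) (G : MvPolynomial (Fin (n + 1)) ℂ) : MvPolynomial (Expo n d) ℂ :=
  linForm fun a => coeff a.1 G / a.1.multinomial

theorem eval_hyperplaneForm {G : MvPolynomial (Fin (n + 1)) ℂ} (hG : G.IsHomogeneous d)
    (u : Fin (n + 1) → ℂ) :
    eval (coords n d (linForm u ^ d)) (hyperplaneForm d G) = eval u G := by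
  rw [eval_eq_sum_expo hG, hyperplaneForm, eval_linForm]
  refine Finset.sum_congr rfl fun a _ => ?_
  rw [coords_linForm_pow, ← mul_assoc, div_mul_cancel₀ _ a.multinomial_ne_zero]

theorem eval_hyperplaneForm_linForm_pow (c u : Fin (n + 1) → ℂ) :
    eval (coords n d (linForm u ^ d)) (hyperplaneForm d (linForm c ^ d)) =
      (∑ i, c i * u i) ^ d := by
  rw [eval_hyperplaneForm (isHomogeneous_linForm_pow c d), map_pow, eval_linForm]

theorem hyperplaneForm_linForm_pow (c : Fin (n + 1) → ℂ) :
    hyperplaneForm d (linForm c ^ d) = ∑ a : Expo n d, eval c (monomial a.1 1) • X a := by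
  refine Finset.sum_congr rfl fun a _ => ?_
  change (coords n d (linForm c ^ d) a / _) • _ = _
  rw [coords_linForm_pow, mul_div_cancel_left₀ _ a.multinomial_ne_zero, eval_monomial, one_mul,
    Finsupp.prod_fintype _ _ fun _ => pow_zero _]

theorem InVeronese.exists_hyperplaneForm_notMem (hd : 1 ≤ d) {Z : ProjSubscheme (Expo n d)}
    (hZ : InVeronese Z) {Q : Ideal (MvPolynomial (Expo n d) ℂ)} [Q.IsPrime] (hle : Z.ideal ≤ Q)
    {a : Expo n d} (ha : X a ∉ Q) :
    ∃ c : Fin (n + 1) → ℂ, hyperplaneForm d (linForm c ^ d) ∉ Q := by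
  by_contra! hall
  let y (i : Fin (n + 1)) : MvPolynomial (Expo n d) ℂ :=
    hyperplaneForm d (linForm (Pi.single i 1) ^ d)
  have hmem : X a ^ d - C ((a.1.multinomial : ℂ) ^ d) * ∏ i, y i ^ a.1 i ∈ Q := by
    refine hle (hZ.mem_ideal fun u => ?_)
    have hy (i) : eval (coords n d (linForm u ^ d)) (y i) = u i ^ d := by
      simp [y, eval_hyperplaneForm_linForm_pow, Pi.single_apply]
    simp only [map_sub, map_mul, map_pow, eval_X, eval_C, map_prod, hy, coords_linForm_pow, mul_pow,
      ← Finset.prod_pow, ← pow_mul, mul_comm d, sub_self]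
  obtain ⟨i, -, hi⟩ : ∃ i ∈ Finset.univ, a.1 i ≠ 0 :=
    Finset.exists_ne_zero_of_sum_ne_zero (a.sum_eq.trans_ne (by omega))
  have hprod : ∏ i, y i ^ a.1 i ∈ Q :=
    Ideal.prod_mem _ (Finset.mem_univ i)
      (Ideal.pow_mem_of_mem _ (hall _) _ (Nat.pos_of_ne_zero hi))
  exact ha (Ideal.IsPrime.mem_of_pow_mem ‹_› _
    ((Submodule.sub_mem_iff_left _ (Q.mul_mem_left _ hprod)).1 hmem))

theorem InVeronese.exists_regular_hyperplaneForm (hd : 1 ≤ d) {Z : ProjSubscheme (Expo n d)}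
    (hZ : InVeronese Z) : ∃ c : Fin (n + 1) → ℂ, ∀ G,
      hyperplaneForm d (linForm c ^ d) * G ∈ Z.ideal → G ∈ Z.ideal := by
  let T := MvPolynomial (Expo n d) ℂ
  obtain ⟨c, hc⟩ := exists_forall_sum_eval_smul_notMem (fun a : Expo n d => monomial a.1 1) X
    (associatedPrimes.finite T (T ⧸ Z.ideal)) (fun Q => Q.restrictScalars ℂ) fun Q hQ => by
      obtain ⟨a, ha⟩ := Z.exists_X_notMem_of_mem_associatedPrimes hQ
      have := hQ.isPrime
      have hle : Z.ideal ≤ Q := by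
        simpa only [Submodule.annihilator_top, Ideal.annihilator_quotient] using hQ.annihilator_le
      obtain ⟨c, hc⟩ := hZ.exists_hyperplaneForm_notMem hd hle ha
      exact ⟨c, hyperplaneForm_linForm_pow c ▸ hc⟩
  simp only [← hyperplaneForm_linForm_pow, Submodule.restrictScalars_mem] at hc
  have hreg : IsSMulRegular (T ⧸ Z.ideal) (hyperplaneForm d (linForm c ^ d)) := by
    by_contra hnot
    rw [← Set.mem_ofPred (p := IsSMulRegular (T ⧸ Z.ideal)), ← Set.mem_compl_iff,
      ← biUnion_associatedPrimes_eq_compl_regular] at hnot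
    obtain ⟨Q, hQ, hmem⟩ := Set.mem_iUnion₂.1 hnot
    exact hc Q hQ hmem
  refine ⟨c, fun G hG => Ideal.Quotient.eq_zero_iff_mem.1
    (hreg.right_eq_zero_of_smul (Ideal.Quotient.eq_zero_iff_mem.2 hG))⟩

theorem InVeronese.restr_X (hd : 1 ≤ d) {Z : ProjSubscheme (Expo n d)} (hZ : InVeronese Z)
    (c : Fin (n + 1) → ℂ) (a : Expo n d) :
    Z.restr (hyperplaneForm d (linForm c ^ d)) (X a) =
      coeff a.1 (linForm (fun i => Z.restr (hyperplaneForm d (linForm c ^ d))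
        (hyperplaneForm d (X i * linForm c ^ (d - 1)))) ^ d) := by
  set l := hyperplaneForm d (linForm c ^ d)
  have hhom (i) : (X i * linForm c ^ (d - 1)).IsHomogeneous d := by
    have := (isHomogeneous_X ℂ i).mul (isHomogeneous_linForm_pow c (d - 1))
    rwa [Nat.add_sub_cancel' hd] at this
  have hmem : X a * l ^ (d - 1) - (a.1.multinomial : MvPolynomial (Expo n d) ℂ) *
      ∏ i, hyperplaneForm d (X i * linForm c ^ (d - 1)) ^ a.1 i ∈ Z.ideal := by
    refine hZ.mem_ideal fun u => ?_
    simp only [map_sub, map_mul, map_pow, map_prod, map_natCast, eval_X, coords_linForm_pow, l,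
      eval_hyperplaneForm_linForm_pow, eval_hyperplaneForm (hhom _), eval_linForm, mul_pow,
      Finset.prod_mul_distrib, Finset.prod_pow_eq_pow_sum, a.sum_eq]
    ring
  have hrestr := Z.restr_of_mem (l := l) hmem
  simp only [map_sub, map_mul, map_pow, map_prod, map_natCast, Z.restr_self, one_pow, mul_one,
    sub_eq_zero] at hrestr
  rw [hrestr, ← coeff_linForm_pow, a.degree_eq]

theorem InVeronese.exists_isDualForm (hd : 1 ≤ d) {Z : ProjSubscheme (Expo n d)}
    (hZ : InVeronese Z) {P : MvPolynomial (Fin (n + 1)) ℂ} (hP : P.IsHomogeneous d)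
    (hspan : coords n d P ∈ Z.span) : ∃ l : MvPolynomial (Expo n d) ℂ, l.IsHomogeneous 1 ∧
      ∃ (φ : Z.AffineRing l →ₗ[ℂ] ℂ) (y : Fin (n + 1) → Z.AffineRing l), IsDualForm φ y d P := by
  obtain ⟨c, hreg⟩ := hZ.exists_regular_hyperplaneForm hd
  have hl : (hyperplaneForm d (linForm c ^ d)).IsHomogeneous 1 := isHomogeneous_linForm _
  obtain ⟨φ, hφ⟩ := Z.exists_dual_restr_eq hl hreg hspan
  refine ⟨_, hl, φ, fun i => Z.restr (hyperplaneForm d (linForm c ^ d))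
    (hyperplaneForm d (X i * linForm c ^ (d - 1))), .of_forall_degree_eq hP fun m hm => ?_⟩
  let a : Expo n d := ⟨m, Finset.mem_finsuppAntidiag.2
    ⟨by rw [← Finsupp.degree_eq_sum, hm], Finset.subset_univ _⟩⟩
  exact (hφ a).symm.trans (congrArg φ (hZ.restr_X hd c a))

theorem exists_mem_powerSumLengths_le (hd : 1 ≤ d) {P : MvPolynomial (Fin (n + 1)) ℂ}
    (hP : P.IsHomogeneous d) (hP0 : P ≠ 0) {k : ℕ} (hk : k ∈ curvilinearLengths n d P) :
    ∃ r ∈ powerSumLengths n d P, (r : ℤ) ≤ (k - 1) * d + 2 - k := by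
  obtain ⟨Z, hdeg, hcurv, hver, hspan⟩ := hk
  obtain ⟨l, hl, φ, y, h⟩ := hver.exists_isDualForm hd hP hspan
  have hrank := Z.rank_affineRing_le hl hdeg
  have : Module.Finite ℂ (Z.AffineRing l) :=
    Module.rank_lt_aleph0_iff.1 (hrank.trans_lt Cardinal.natCast_lt_aleph0)
  have hfinrank : Module.finrank ℂ (Z.AffineRing l) ≤ k := by
    rw [← Module.finrank_eq_rank] at hrank
    exact_mod_cast hrank
  obtain ⟨j, hj, hsum⟩ := h.exists_isSumOfPowers hd hP0 fun m _ => hcurv.exists_le_span_sup_sq hl m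
  refine ⟨_, hsum, ?_⟩
  have hjk : (j : ℤ) + 1 ≤ k := mod_cast hj.trans hfinrank
  have hd' : (1 : ℤ) ≤ d := mod_cast hd
  push_cast [hd]
  linarith [mul_le_mul_of_nonneg_right hjk (sub_nonneg.2 hd')]

end Veronese

section AlongLine

variable {σ R : Type*} [CommSemiring R]

/-- Restriction of polynomials to the line spanned by `v`, parametrized by `z ↦ z • v`. -/
def alongLine (v : σ → R) : MvPolynomial σ R →ₐ[R] R[X] :=
  aeval fun i => Polynomial.C (v i) * Polynomial.X

theorem alongLine_X (v : σ → R) (i : σ) :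
    alongLine v (X i) = Polynomial.C (v i) * Polynomial.X :=
  aeval_X _ i

theorem eval_alongLine (v : σ → R) (F : MvPolynomial σ R) (z : R) :
    (alongLine v F).eval z = eval (z • v) F := by
  have h := comp_aeval_apply (fun i => Polynomial.C (v i) * Polynomial.X) (Polynomial.aeval z) F
  simpa [alongLine, Polynomial.coe_aeval_eq_eval, aeval_eq_eval, Pi.smul_def, mul_comm z] using h

theorem coeff_alongLine (v : σ → R) (F : MvPolynomial σ R) (t : ℕ) :
    (alongLine v F).coeff t = eval v (homogeneousComponent t F) := by
  induction F using MvPolynomial.induction_on' with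
  | monomial m c =>
    have hm : alongLine v (monomial m c) =
        Polynomial.monomial m.degree (eval v (monomial m c)) := by
      simp [alongLine, aeval_monomial, eval_monomial, mul_pow, Finsupp.prod,
        Finset.prod_mul_distrib, Finset.prod_pow_eq_pow_sum, ← Polynomial.C_mul_X_pow_eq_monomial,
        Finsupp.degree_apply, mul_assoc]
    rw [hm, Polynomial.coeff_monomial, homogeneousComponent_of_mem (isHomogeneous_monomial c rfl),
      apply_ite (eval v), map_zero]
    simp only [eq_comm]
  | add p q hp hq => simp only [map_add, Polynomial.coeff_add, hp, hq]

theorem alongLine_of_isHomogeneous (v : σ → R) {F : MvPolynomial σ R} {t : ℕ}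
    (hF : F.IsHomogeneous t) : alongLine v F = Polynomial.monomial t (eval v F) := by
  ext s
  rw [coeff_alongLine, homogeneousComponent_of_mem hF, Polynomial.coeff_monomial,
    apply_ite (eval v), map_zero]
  simp only [eq_comm]

end AlongLine

namespace ProjSubscheme

section Points

variable {σ ι : Type*}

/-- The reduced union of the points `[v i]`. -/
def ofPoints (v : ι → σ → ℂ) (hv : ∀ i, v i ≠ 0) : ProjSubscheme σ where
  ideal := ⨅ i, RingHom.ker (alongLine (v i))
  homogeneous F hF t := by
    simp only [Ideal.mem_iInf, RingHom.mem_ker] at hF ⊢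
    intro i
    rw [alongLine_of_isHomogeneous _ (homogeneousComponent_isHomogeneous t F), ← coeff_alongLine,
      hF, Polynomial.coeff_zero, map_zero]
  saturated F hF := by
    simp only [Ideal.mem_iInf, RingHom.mem_ker, map_mul, alongLine_X] at hF ⊢
    intro i
    obtain ⟨j, hj⟩ := Function.ne_iff.1 (hv i)
    exact (mul_eq_zero.1 (hF j i)).resolve_left
      (mul_ne_zero (Polynomial.C_ne_zero.2 hj) Polynomial.X_ne_zero)

theorem mem_ofPoints_ideal {v : ι → σ → ℂ} {hv : ∀ i, v i ≠ 0} {F : MvPolynomial σ ℂ} :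
    F ∈ (ofPoints v hv).ideal ↔ ∀ i, alongLine (v i) F = 0 := by
  simp [ofPoints, RingHom.mem_ker]

theorem mem_ofPoints_ideal_of_isHomogeneous {v : ι → σ → ℂ} {hv : ∀ i, v i ≠ 0}
    {F : MvPolynomial σ ℂ} {t : ℕ} (hF : F.IsHomogeneous t) :
    F ∈ (ofPoints v hv).ideal ↔ ∀ i, eval (v i) F = 0 := by
  simp only [mem_ofPoints_ideal, alongLine_of_isHomogeneous _ hF, Polynomial.monomial_eq_zero_iff]

end Points

section Basis

variable {σ ι : Type*} [Fintype σ] (b : Module.Basis ι ℂ (σ → ℂ))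

open scoped Classical in
/-- The linear form whose value at a vector is its `i`-th coordinate in the basis `b`. -/
def coordForm (i : ι) : MvPolynomial σ ℂ :=
  linForm fun j => b.coord i (Pi.single j 1)

theorem eval_coordForm (i : ι) (w : σ → ℂ) : eval w (coordForm b i) = b.repr w i := by
  classical
  exact eval_linForm_dual (b.coord i) w

theorem differential_coordForm (i : ι) (v w : σ → ℂ) :
    differential v (coordForm b i) w = b.repr w i := by
  rw [coordForm, differential_linForm, ← coordForm, eval_coordForm]

omit [Fintype σ] in
theorem isZeroDimOfDegree_ofPoints [Finite σ] [Fintype ι] :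
    (ofPoints b b.ne_zero).IsZeroDimOfDegree (Fintype.card ι) := by
  cases nonempty_fintype σ
  classical
  refine (eventually_ge_atTop 1).mono fun t ht => ?_
  let f : homogeneousSubmodule σ ℂ t →ₗ[ℂ] ι → ℂ :=
    (LinearMap.pi fun i => (aeval (b i)).toLinearMap) ∘ₗ Submodule.subtype _
  have hf (F i) : f F i = eval (b i) F.1 := rfl
  have hker : ((ofPoints b b.ne_zero).ideal.restrictScalars ℂ).submoduleOf
      (homogeneousSubmodule σ ℂ t) = LinearMap.ker f := by
    ext F
    exact (mem_ofPoints_ideal_of_isHomogeneous (hv := b.ne_zero) F.2).trans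
      (funext_iff (f := f F) (g := 0)).symm
  have hsurj : Function.Surjective f := fun z => by
    refine ⟨⟨∑ i, z i • coordForm b i ^ t, sum_mem fun i _ => Submodule.smul_mem _ _
      (isHomogeneous_linForm_pow _ t)⟩, funext fun j => ?_⟩
    rw [hf, map_sum]
    simp [smul_eval, eval_coordForm, Finsupp.single_apply, ite_pow, Nat.one_le_iff_ne_zero.1 ht]
  rw [hilbertFunction, hker, (f.quotKerEquivOfSurjective hsurj).finrank_eq,
    Module.finrank_fintype_fun_eq_card]

theorem coordForm_mul_mem_ofPoints_ideal {i j : ι} (hij : i ≠ j) :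
    coordForm b i * coordForm b j ∈ (ofPoints b b.ne_zero).ideal := by
  rw [mem_ofPoints_ideal_of_isHomogeneous (F := coordForm b i * coordForm b j)
    ((isHomogeneous_linForm _).mul (isHomogeneous_linForm _))]
  intro k
  classical
  simp only [map_mul, eval_coordForm, b.repr_self, Finsupp.single_apply]
  split_ifs with hi hj <;> simp_all

theorem tangentSpace_ofPoints {v : σ → ℂ} (hv : (ofPoints b b.ne_zero).HasPoint v) :
    (ofPoints b b.ne_zero).tangentSpace v = ⊥ := by
  obtain ⟨i, hi⟩ : ∃ i, b.repr v i ≠ 0 := by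
    by_contra! h
    exact hv.1 (b.ext_elem fun i => by rw [h i, map_zero, Finsupp.zero_apply])
  have hvj {j : ι} (hij : i ≠ j) : b.repr v j = 0 := by
    have h := hv.2 _ (coordForm_mul_mem_ofPoints_ideal b hij)
    rw [map_mul, eval_coordForm, eval_coordForm] at h
    exact (mul_eq_zero.1 h).resolve_left hi
  rw [eq_bot_iff]
  rintro _ ⟨w, hw, rfl⟩
  simp only [SetLike.mem_coe, Submodule.mem_iInf] at hw
  change ∀ F ∈ (ofPoints b b.ne_zero).ideal, differential v F w = 0 at hw
  have hwj {j : ι} (hij : i ≠ j) : b.repr w j = 0 := by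
    have h := hw _ (coordForm_mul_mem_ofPoints_ideal b hij)
    rw [differential_mul, LinearMap.add_apply, LinearMap.smul_apply, LinearMap.smul_apply,
      differential_coordForm, differential_coordForm, eval_coordForm, eval_coordForm, hvj hij,
      zero_smul, add_zero, smul_eq_mul] at h
    exact (mul_eq_zero.1 h).resolve_left hi
  refine (Submodule.Quotient.mk_eq_zero _).2 (Submodule.mem_span_singleton.2
    ⟨b.repr w i / b.repr v i, b.ext_elem fun j => ?_⟩)
  rw [map_smul, Finsupp.smul_apply, smul_eq_mul]
  rcases eq_or_ne i j with rfl | hij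
  · exact div_mul_cancel₀ _ hi
  · rw [hvj hij, hwj hij, mul_zero]

theorem isCurvilinear_ofPoints : (ofPoints b b.ne_zero).IsCurvilinear := fun v hv => by
  rw [tangentSpace_ofPoints b hv, finrank_bot]
  exact zero_le_one

omit [Fintype σ] in
theorem span_ofPoints [Finite σ] : (ofPoints b b.ne_zero).span = Set.univ := by
  cases nonempty_fintype σ
  refine Set.eq_univ_of_forall fun v F hF hF1 => ?_
  rw [mem_ofPoints_ideal_of_isHomogeneous hF1] at hF
  obtain ⟨c, rfl⟩ := exists_eq_linForm hF1
  have hc : Fintype.linearCombination ℂ c = 0 := b.ext fun i => by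
    simpa [eval_linForm, Fintype.linearCombination_apply, mul_comm] using hF i
  simpa [eval_linForm, Fintype.linearCombination_apply, mul_comm] using LinearMap.congr_fun hc v

end Basis

end ProjSubscheme

section Nonempty

variable {n d : ℕ}

theorem span_veroneseCone : Submodule.span ℂ (veroneseCone n d) = ⊤ := by
  classical
  by_contra hne
  obtain ⟨f, hf0, hf⟩ := Submodule.exists_le_ker_of_lt_top _ (lt_top_iff_ne_top.2 hne)
  let G : MvPolynomial (Fin (n + 1)) ℂ :=
    ∑ a : Expo n d, monomial a.1 (a.1.multinomial * f (Pi.single a 1))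
  have hG : G = 0 := MvPolynomial.funext fun u => by
    have hu : f (coords n d (linForm u ^ d)) = 0 :=
      hf (Submodule.subset_span ⟨_, isHomogeneous_linForm u, rfl⟩)
    rw [← eval_linForm_dual, eval_linForm] at hu
    simp only [map_zero, ← hu, G, map_sum, eval_monomial, coords_linForm_pow]
    refine Finset.sum_congr rfl fun a _ => ?_
    rw [Finsupp.prod_fintype _ _ fun _ => pow_zero _]
    ring
  refine hf0 (LinearMap.pi_ext' fun a => LinearMap.ext_ring ?_)
  have hcoeff := congrArg (coeff a.1) hG
  simpa [G, coeff_sum, coeff_monomial, Subtype.coe_inj, a.multinomial_ne_zero] using hcoeff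

theorem smul_mem_veroneseCone (hd : 1 ≤ d) (z : ℂ) {v : Expo n d → ℂ} (hv : v ∈ veroneseCone n d) :
    z • v ∈ veroneseCone n d := by
  obtain ⟨L, hL, rfl⟩ := hv
  obtain ⟨r, rfl⟩ := IsAlgClosed.exists_pow_nat_eq z hd
  refine ⟨r • L, (homogeneousSubmodule _ ℂ 1).smul_mem r hL, ?_⟩
  ext a
  simp [coords, smul_pow]

theorem inVeronese_ofPoints (hd : 1 ≤ d) {ι : Type*} {v : ι → Expo n d → ℂ} (hv : ∀ i, v i ≠ 0)
    (hmem : ∀ i, v i ∈ veroneseCone n d) : InVeronese (ProjSubscheme.ofPoints v hv) :=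
  fun F hF => ProjSubscheme.mem_ofPoints_ideal.2 fun i => Polynomial.funext fun z => by
    rw [eval_alongLine, Polynomial.eval_zero]
    exact mem_vanishingIdeal_iff.1 hF _ (smul_mem_veroneseCone hd z (hmem i))

theorem curvilinearLengths_nonempty (hd : 1 ≤ d) (P : MvPolynomial (Fin (n + 1)) ℂ) :
    (curvilinearLengths n d P).Nonempty := by
  let b := Module.Basis.ofSpan (span_veroneseCone (n := n) (d := d)).ge
  have := FiniteDimensional.fintypeBasisIndex b
  refine ⟨_, .ofPoints b b.ne_zero, ProjSubscheme.isZeroDimOfDegree_ofPoints b,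
    ProjSubscheme.isCurvilinear_ofPoints b, inVeronese_ofPoints hd _ fun i =>
      Module.Basis.ofSpan_subset _ (Set.mem_range_self i), ?_⟩
  rw [ProjSubscheme.span_ofPoints]
  exact Set.mem_univ _

end Nonempty

end CurvilinearRank

end

/-- The first two conjuncts say that the minima defining the two ranks are over nonempty sets. -/
theorem theorem1 (n d : ℕ) (hd : 1 ≤ d) (P : MvPolynomial (Fin (n + 1)) ℂ)
    (hP : P.IsHomogeneous d) (hP0 : P ≠ 0) :
    (CurvilinearRank.powerSumLengths n d P).Nonempty ∧
    (CurvilinearRank.curvilinearLengths n d P).Nonempty ∧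
    (CurvilinearRank.rank n d P : ℤ) ≤
      ((CurvilinearRank.curvilinearRank n d P : ℤ) - 1) * d + 2
        - CurvilinearRank.curvilinearRank n d P := by
  have hne := CurvilinearRank.curvilinearLengths_nonempty hd P
  obtain ⟨r, hr, hle⟩ :=
    CurvilinearRank.exists_mem_powerSumLengths_le hd hP hP0 (Nat.sInf_mem hne)
  exact ⟨⟨r, hr⟩, hne, (Nat.cast_le.2 (Nat.sInf_le hr)).trans hle⟩
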